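/- Let $\Psi$ be a measurable space in which some countable family of measurable sets separates points (for instance a standard Borel space). Let $\theta>0$, $\gamma>0$, and let $H=\sum_l \rho_l\delta_{x_l}+H_{ord}$ be a measure on $\Psi$, where the $x_l$ are finitely or countably many (possibly no) distinct points, $\gamma\rho_l\in(0,1)$ for all $l$, and $H_{ord}$ is a probability measure without atoms. Given a family of probability laws $(F_l)$ on $(0,\infty)$ and a measure $\nu$ on $(0,\infty)$, consider the completely random measure $$\sum_l \eta_l\,\delta_{x_l}+\sum_j \xi_j\,\delta_{y_j},$$ where the fixed atom weights $\eta_l$ are independent with $\eta_l\sim F_l$, and, independently of them, the pairs $(y_j,\xi_j)$ are the points of a Poisson process on $\Psi\times(0,\infty)$ with intensity $H_{ord}\times\nu$. A random measure is a *beta process* $\mathrm{BP}(\theta,\gamma,H)$ if it has the law of this random measure for $$F_l=\mathrm{Beta}\bigl(\theta\gamma\rho_l,\ \theta(1-\gamma\rho_l)\bigr),\qquad \nu(db)=\gamma\theta\, b^{-1}(1-b)^{\theta-1}\,db\ \text{ on }(0,1),$$ and a *beta prime process* $\mathrm{BPP}(\theta,\gamma,H)$ if it has the law of this random measure for $$F_l=\mathrm{BetaPrime}\bigl(\theta\gamma\rho_l,\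 \theta(1-\gamma\rho_l)\bigr),\qquad \nu(du)=\gamma\theta\, u^{-1}(1+u)^{-\theta}\,du\ \text{ on }(0,\infty),$$ where $\mathrm{BetaPrime}(a,c)$ has density $\frac{\Gamma(a+c)}{\Gamma(a)\Gamma(c)}z^{a-1}(1+z)^{-a-c}$ on $(0,\infty)$. **Proposition.** On a probability space let $b_k\ge 0$ be real random variables and $\psi_k$ be $\Psi$-valued random elements, $k\in\mathbb N$, with $\psi_1,\psi_2,\dots$ almost surely pairwise distinct. If $B=\sum_k b_k\,\delta_{\psi_k}\sim \mathrm{BP}(\theta,\gamma,H)$, then $$\sum_k \frac{b_k}{1-b_k}\,\delta_{\psi_k}\sim \mathrm{BPP}(\theta,\gamma,H).$$ -/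

import Mathlib

open MeasureTheory ProbabilityTheory Set
open scoped ENNReal NNReal

noncomputable section

namespace BetaPrime

/-- A point measure: a finite or countably infinite sum of unit point masses. -/
def IsPointMeasure {E : Type*} [MeasurableSpace E] (m : Measure E) : Prop :=
  ∃ (s : Set ℕ) (x : s → E), m = Measure.sum (fun i => Measure.dirac (x i))

/-- `N` is a Poisson point process on `E` with intensity measure `μ`: almost surely `N` is a point
measure, the number of points in a measurable set `A` is Poisson with mean `μ A` (and is almost
surely infinite if `μ A = ∞`), and the numbers of points in finitely many pairwise disjoint
measurable sets are independent. -/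
structure IsPoissonProcess {Ω E : Type*} [MeasurableSpace Ω] [MeasurableSpace E]
    (P : Measure Ω) (N : Ω → Measure E) (μ : Measure E) : Prop where
  measurable : Measurable N
  isPointMeasure : ∀ᵐ ω ∂P, IsPointMeasure (N ω)
  law_count : ∀ A : Set E, MeasurableSet A → μ A ≠ ∞ →
    HasLaw (fun ω => N ω A)
      ((poissonMeasure (μ A).toNNReal).map (fun n : ℕ => (n : ℝ≥0∞))) P
  count_infinite : ∀ A : Set E, MeasurableSet A → μ A = ∞ → ∀ᵐ ω ∂P, N ω A = ∞
  indep : ∀ (n : ℕ) (A : Fin n → Set E), (∀ i, MeasurableSet (A i)) →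
    Pairwise (fun i j => Disjoint (A i) (A j)) →
    iIndepFun (fun i ω => N ω (A i)) P

/-- The measure `∑ᵢ wᵢ δ_{xᵢ} + ∑_{(ψ, u) point of N} u δ_ψ`, with fixed locations `xᵢ`. The second
summand gives a measurable set `A` the mass `∫ 1_A(ψ) u N(dψ, du)`. -/
def assemble {Ψ ι : Type*} [MeasurableSpace Ψ] (x : ι → Ψ)
    (c : Measure (Ψ × ℝ) × (ι → ℝ)) : Measure Ψ :=
  Measure.sum (fun i => ENNReal.ofReal (c.2 i) • Measure.dirac (x i))
    + (c.1.withDensity (fun p => ENNReal.ofReal p.2)).map Prod.fst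

/-- The random measure `B` has the law of the completely random measure with no deterministic
component, with fixed atoms at the locations `x i` whose independent weights have the laws `F i`,
and with an independent ordinary component given by a Poisson process of pairs (location, weight)
with intensity `μ`. Here `R` is the joint law of the Poisson process and the fixed weights. -/
def IsCRM {Ω Ψ ι : Type*} [MeasurableSpace Ω] [MeasurableSpace Ψ]
    (P : Measure Ω) (B : Ω → Measure Ψ)
    (x : ι → Ψ) (F : ι → Measure ℝ) (μ : Measure (Ψ × ℝ)) : Prop :=
  ∃ R : Measure (Measure (Ψ × ℝ) × (ι → ℝ)), IsProbabilityMeasure R ∧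
    IsPoissonProcess R (fun c => c.1) μ ∧
    (∀ i, HasLaw (fun c => c.2 i) (F i) R) ∧
    iIndepFun (fun i c => c.2 i) R ∧
    IndepFun (fun c => c.1) (fun c => c.2) R ∧
    HasLaw B (R.map (assemble x)) P

/-- The set of atoms of a measure. -/
def atoms {Ψ : Type*} [MeasurableSpace Ψ] (H : Measure Ψ) : Set Ψ := {x | H {x} ≠ 0}

/-- The part `H_ord` of `H` outside its atoms. -/
def ordinaryPart {Ψ : Type*} [MeasurableSpace Ψ] (H : Measure Ψ) : Measure Ψ :=
  H.restrict (atoms H)ᶜ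

/-- `H` is an admissible base measure for the mass parameter `γ`: it is the sum
`∑ₗ ρₗ δ_{xₗ} + H_ord` of a purely atomic measure with at most countably many atoms, whose masses
satisfy `γ ρₗ ∈ (0, 1)`, and an atomless probability measure `H_ord`. -/
structure IsBaseMeasure {Ψ : Type*} [MeasurableSpace Ψ] (γ : ℝ) (H : Measure Ψ) : Prop where
  countable_atoms : (atoms H).Countable
  mass_lt_one : ∀ x, ENNReal.ofReal γ * H {x} < 1
  ordinary_prob : IsProbabilityMeasure (ordinaryPart H)

/-- The measure `γ θ b⁻¹ (1 - b)^(θ - 1) db` on `(0, 1)`. -/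
def betaIntensity (θ γ : ℝ) : Measure ℝ :=
  (volume.restrict (Ioo 0 1)).withDensity
    (fun b => ENNReal.ofReal (γ * θ * b⁻¹ * (1 - b) ^ (θ - 1)))

/-- The measure `γ θ u⁻¹ (1 + u)^(-θ) du` on `(0, ∞)`. -/
def betaPrimeIntensity (θ γ : ℝ) : Measure ℝ :=
  (volume.restrict (Ioi 0)).withDensity
    (fun u => ENNReal.ofReal (γ * θ * u⁻¹ * (1 + u) ^ (-θ)))

/-- The beta prime distribution, with density
`Γ(a + b) / (Γ(a) Γ(b)) z^(a - 1) (1 + z)^(-a - b)` on `(0, ∞)`. -/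
def betaPrimeMeasure (a b : ℝ) : Measure ℝ :=
  (volume.restrict (Ioi 0)).withDensity
    (fun z => ENNReal.ofReal (Real.Gamma (a + b) / (Real.Gamma a * Real.Gamma b)
      * z ^ (a - 1) * (1 + z) ^ (-a - b)))

/-- `B ∼ BP(θ, γ, H)`: a beta process with concentration `θ`, mass `γ` and base measure `H`. -/
def IsBetaProcess {Ω Ψ : Type*} [MeasurableSpace Ω] [MeasurableSpace Ψ]
    (θ γ : ℝ) (H : Measure Ψ) (P : Measure Ω) (B : Ω → Measure Ψ) : Prop :=
  IsCRM P B (fun x : atoms H => (x : Ψ))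
    (fun x => betaMeasure (θ * (γ * H.real {(x : Ψ)})) (θ * (1 - γ * H.real {(x : Ψ)})))
    ((ordinaryPart H).prod (betaIntensity θ γ))

/-- `B ∼ BPP(θ, γ, H)`: a beta prime process with parameters `θ`, `γ` and base measure `H`. -/
def IsBetaPrimeProcess {Ω Ψ : Type*} [MeasurableSpace Ω] [MeasurableSpace Ψ]
    (θ γ : ℝ) (H : Measure Ψ) (P : Measure Ω) (B : Ω → Measure Ψ) : Prop :=
  IsCRM P B (fun x : atoms H => (x : Ψ))
    (fun x => betaPrimeMeasure (θ * (γ * H.real {(x : Ψ)})) (θ * (1 - γ * H.real {(x : Ψ)})))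
    ((ordinaryPart H).prod (betaPrimeIntensity θ γ))

/-- The random measure `∑ₖ bₖ δ_{ψₖ}`. -/
def atomicMeasure {Ω Ψ : Type*} [MeasurableSpace Ψ] (b : ℕ → Ω → ℝ) (ψ : ℕ → Ω → Ψ) (ω : Ω) :
    Measure Ψ :=
  Measure.sum (fun k => ENNReal.ofReal (b k ω) • Measure.dirac (ψ k ω))

end BetaPrime

end

/-!
The map `b ↦ b / (1 - b)` carries `(0, 1)` onto `(0, ∞)`, the beta distribution to the beta prime
distribution (`map_oddsEquiv_betaMeasure`) and the Lévy measure of the beta process to that of the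
beta prime process (`map_oddsEquiv_betaIntensity`). Applying it to all weights in the completely
random measure therefore turns the law `BP` into `BPP`: the image of a Poisson process under a
measurable bijection is a Poisson process, and independence of the fixed weights is preserved.

The hypothesis only concerns the law of `B = ∑ₖ bₖ δ_{ψₖ}`, not the pairs `(ψₖ, bₖ)`, so the weights
have to be transformed by a measurable operation on measures. That operation is
`T m = m.withDensity (x ↦ oddsRatio (m {x}))`, where `t * oddsRatio t = t / (1 - t)`. It sends
`∑ₖ wₖ δ_{zₖ}` with distinct `zₖ` to `∑ₖ wₖ / (1 - wₖ) δ_{zₖ}`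
(`sum_dirac_withDensity_oddsRatio`). Three points need an argument.

* `T` is measurable (`exists_measurable_withDensity_singleton`). On a set of finite mass,
  `m {x}` is the infimum of the masses of the cells containing `x` in an increasing sequence of
  finite measurable partitions that separates points; this makes `(m, x) ↦ m {x}` jointly
  measurable. The random measure has finite mass on each fixed atom and on the complement of the
  fixed atoms, because `∫ b ν(db) = γ` (`lintegral_betaIntensity`, `IsPoissonProcess.bind_eq`). Its
  total mass may be infinite, hence the partition `fixedCells`.
* The points of the Poisson process have distinct locations almost surely
  (`IsPoissonProcess.ae_forall_fiber_le_one`): a cell of mean `λ` holds two points with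
  probability at most `λ ^ 2`, and the sum of the squared means over the cells of the `k`-th
  partition tends to a multiple of the mass of the diagonal under the square of the atomless
  measure, which is zero.
* The Poisson process almost surely has positive weights and no location at a fixed atom, since
  its mean measure is the intensity (`IsPoissonProcess.bind_eq`).

`IsCRM.atomicMeasure_odds` puts these together for an arbitrary completely random measure.
-/

noncomputable section

namespace BetaPrime

open Filter Topology

/-! ### The odds transformation -/

/-- The map `b ↦ b / (1 - b)` as a measurable bijection of `ℝ`. The Möbius transformation misses `-1`
and has a pole at `1`, so `1` is sent to `-1`. Being a bijection of all of `ℝ`, it transports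
almost sure statements about sets that are not known to be measurable. -/
def oddsEquiv : ℝ ≃ᵐ ℝ where
  toFun b := if b = 1 then -1 else b / (1 - b)
  invFun u := if u = -1 then 1 else u / (1 + u)
  left_inv b := by
    by_cases h : b = 1
    · simp [h]
    · have h1 : 1 - b ≠ 0 := sub_ne_zero.2 (Ne.symm h)
      have h2 : b / (1 - b) ≠ -1 := by
        intro h3; rw [div_eq_iff h1] at h3; linarith
      have h4 : 1 + b / (1 - b) = 1 / (1 - b) := by field_simp; ring
      simp only [h, h2, if_false, h4]
      field_simp
  right_inv u := by
    by_cases h : u = -1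
    · simp [h]
    · have h1 : 1 + u ≠ 0 := fun h0 => h (by linarith)
      have h2 : u / (1 + u) ≠ 1 := by
        intro h3; rw [div_eq_iff h1] at h3; linarith
      have h4 : 1 - u / (1 + u) = 1 / (1 + u) := by field_simp; ring
      simp only [h, h2, if_false, h4]
      field_simp
  measurable_toFun := Measurable.ite (measurableSet_singleton 1) (by fun_prop) (by fun_prop)
  measurable_invFun := Measurable.ite (measurableSet_singleton (-1)) (by fun_prop) (by fun_prop)

lemma oddsEquiv_apply (b : ℝ) : oddsEquiv b = if b = 1 then -1 else b / (1 - b) := rfl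

lemma oddsEquiv_symm_apply (u : ℝ) :
    oddsEquiv.symm u = if u = -1 then 1 else u / (1 + u) := rfl

/-- As a nonnegative mass, the value of `oddsEquiv` at the pole agrees with the convention
`1 / 0 = 0`. -/
lemma ofReal_oddsEquiv (w : ℝ) :
    ENNReal.ofReal (oddsEquiv w) = ENNReal.ofReal (w / (1 - w)) := by
  rw [oddsEquiv_apply]
  split_ifs with h
  · simp [h]
  · rfl

lemma oddsEquiv_symm_image (A : Set ℝ) :
    (fun u : ℝ => u / (1 + u)) '' (A ∩ Ioi 0) = oddsEquiv ⁻¹' A ∩ Ioo 0 1 := by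
  have key : ∀ u : ℝ, 0 < u → u / (1 + u) = oddsEquiv.symm u := fun u hu => by
    rw [oddsEquiv_symm_apply, if_neg (by linarith)]
  ext b
  constructor
  · rintro ⟨u, ⟨huA, hu⟩, rfl⟩
    have hu : 0 < u := hu
    refine ⟨?_, by positivity, by rw [div_lt_one (by positivity)]; linarith⟩
    simpa [key u hu] using huA
  · rintro ⟨hA, h0, h1⟩
    have hpos : 0 < oddsEquiv b := by
      rw [oddsEquiv_apply, if_neg h1.ne]
      exact div_pos h0 (by linarith)
    exact ⟨oddsEquiv b, ⟨hA, hpos⟩, by simp only [key _ hpos]; simp⟩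

/-- Change of variables `b = u / (1 + u)`, `db = (1 + u)⁻² du`, from `(0, 1)` to `(0, ∞)`. -/
lemma map_oddsEquiv_withDensity (g : ℝ → ℝ≥0∞) :
    ((volume.restrict (Ioo 0 1)).withDensity g).map oddsEquiv =
      (volume.restrict (Ioi 0)).withDensity
        (fun u => ENNReal.ofReal (((1 + u) ^ 2)⁻¹) * g (u / (1 + u))) := by
  ext A hA
  rw [MeasurableEquiv.map_apply, withDensity_apply _ (oddsEquiv.measurable hA),
    withDensity_apply _ hA, Measure.restrict_restrict (oddsEquiv.measurable hA),
    Measure.restrict_restrict hA, ← oddsEquiv_symm_image,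
    lintegral_image_eq_lintegral_abs_deriv_mul (f' := fun u => ((1 + u) ^ 2)⁻¹)
      (hA.inter measurableSet_Ioi)]
  · simp only [abs_inv, abs_pow, sq_abs]
  · rintro u ⟨-, hu⟩
    have hu : 0 < u := hu
    have h1 : (1 : ℝ) + u ≠ 0 := by positivity
    have h := (hasDerivAt_id u).div ((hasDerivAt_id u).const_add 1) h1
    refine (h.congr_deriv ?_).hasDerivWithinAt
    simp only [id]
    field_simp
    ring
  · rintro u ⟨-, hu⟩ v ⟨-, hv⟩ huv
    have hu : 0 < u := hu
    have hv : 0 < v := hv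
    simp only at huv
    rw [div_eq_div_iff (by positivity) (by positivity)] at huv
    linarith

lemma map_oddsEquiv_betaIntensity (θ γ : ℝ) :
    (betaIntensity θ γ).map oddsEquiv = betaPrimeIntensity θ γ := by
  rw [betaIntensity, map_oddsEquiv_withDensity, betaPrimeIntensity]
  refine withDensity_congr_ae ((ae_restrict_mem measurableSet_Ioi).mono fun u hu => ?_)
  have hu : 0 < u := hu
  have h1 : 0 < 1 + u := by positivity
  simp only
  rw [← ENNReal.ofReal_mul (by positivity)]
  congr 1
  have h2 : 1 - u / (1 + u) = (1 + u)⁻¹ := by field_simp; ring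
  rw [h2, Real.inv_rpow h1.le, ← Real.rpow_neg h1.le, inv_div,
    show -θ = -(θ - 1) - 1 by ring, Real.rpow_sub_one h1.ne']
  field_simp

lemma map_oddsEquiv_betaMeasure (a c : ℝ) :
    (betaMeasure a c).map oddsEquiv = betaPrimeMeasure a c := by
  have hbeta : betaMeasure a c = (volume.restrict (Ioo 0 1)).withDensity
      (fun x => ENNReal.ofReal (1 / beta a c * x ^ (a - 1) * (1 - x) ^ (c - 1))) := by
    rw [betaMeasure, ← withDensity_indicator measurableSet_Ioo]
    congr 1
    ext x
    by_cases hx : x ∈ Ioo (0 : ℝ) 1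
    · rw [indicator_of_mem hx, betaPDF_of_pos_lt_one hx.1 hx.2]
    · rw [indicator_of_notMem hx, betaPDF_eq, if_neg (show ¬(0 < x ∧ x < 1) from hx),
         ENNReal.ofReal_zero]
  rw [hbeta, map_oddsEquiv_withDensity, betaPrimeMeasure]
  refine withDensity_congr_ae ((ae_restrict_mem measurableSet_Ioi).mono fun u hu => ?_)
  have hu : 0 < u := hu
  have h1 : 0 < 1 + u := by positivity
  simp only
  rw [← ENNReal.ofReal_mul (by positivity)]
  congr 1
  have h2 : 1 - u / (1 + u) = (1 + u)⁻¹ := by field_simp; ring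
  rw [h2, Real.inv_rpow h1.le, ← Real.rpow_neg h1.le, Real.div_rpow hu.le h1.le,
    show -a - c = -(c - 1) - (a - 1) - (2 : ℕ) by push_cast; ring, Real.rpow_sub_natCast h1.ne',
    Real.rpow_sub h1 (-(c - 1)) (a - 1), beta, one_div_div]
  field_simp

/-! ### The atomwise transformation of a measure -/

/-- The factor `1 / (1 - t)` by which an atom of mass `t` is multiplied, written as
`(t / (1 - t)) / t` so that `t * oddsRatio t` is the real quotient `t / (1 - t)`, cut off at `0`,
for every finite `t`, including `t ≥ 1`. -/
def oddsRatio (t : ℝ≥0∞) : ℝ≥0∞ := ENNReal.ofReal (t.toReal / (1 - t.toReal)) / t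

lemma measurable_oddsRatio : Measurable oddsRatio := by
  unfold oddsRatio
  fun_prop

lemma ofReal_mul_oddsRatio (w : ℝ) :
    ENNReal.ofReal w * oddsRatio (ENNReal.ofReal w) = ENNReal.ofReal (w / (1 - w)) := by
  rcases le_or_gt w 0 with hw | hw
  · rw [ENNReal.ofReal_of_nonpos hw, zero_mul,
      ENNReal.ofReal_of_nonpos (div_nonpos_of_nonpos_of_nonneg hw (by linarith))]
  · rw [oddsRatio, ENNReal.toReal_ofReal hw.le,
      ENNReal.mul_div_cancel (by simpa using hw) ENNReal.ofReal_ne_top]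

lemma sum_dirac_singleton {Ψ κ : Type*} [MeasurableSpace Ψ] [MeasurableSingletonClass Ψ]
    (w : κ → ℝ≥0∞) {z : κ → Ψ} (hz : Function.Injective z) (k : κ) :
    Measure.sum (fun k => w k • Measure.dirac (z k)) {z k} = w k := by
  rw [Measure.sum_apply _ (measurableSet_singleton _), tsum_eq_single k]
  · simp
  · intro j hj
    have : z j ∉ ({z k} : Set Ψ) := fun h => hj (hz h)
    simp [hz.ne hj]

/-- Reweighting an atomic measure with distinct locations by `oddsRatio` of its point masses applies
`w ↦ w / (1 - w)` to every weight. Distinctness is essential: equal locations would merge weights. -/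
lemma sum_dirac_withDensity_oddsRatio {Ψ κ : Type*} [MeasurableSpace Ψ]
    [MeasurableSingletonClass Ψ] (w : κ → ℝ) {z : κ → Ψ} (hz : Function.Injective z)
    {m : Measure Ψ} (hm : m = Measure.sum (fun k => ENNReal.ofReal (w k) • Measure.dirac (z k))) :
    m.withDensity (fun x => oddsRatio (m {x})) =
      Measure.sum (fun k => ENNReal.ofReal (w k / (1 - w k)) • Measure.dirac (z k)) := by
  have hsing : ∀ k, m {z k} = ENNReal.ofReal (w k) := fun k => by
    rw [hm]; exact sum_dirac_singleton (fun k => ENNReal.ofReal (w k)) hz k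
  generalize hf : (fun x => oddsRatio (m {x})) = f
  rw [hm, withDensity_sum]
  congr 1
  ext1 k
  rw [withDensity_smul_measure, dirac_withDensity, smul_smul, ← hf]
  simp only [hsing, ofReal_mul_oddsRatio]

/-- An increasing sequence of finite measurable partitions that separates points; the cells of the
`k`-th one are the fibres of `g k`. -/
lemma exists_finite_separating_maps (Ψ : Type*) [MeasurableSpace Ψ]
    [MeasurableSpace.CountablySeparated Ψ] :
    ∃ g : ∀ k : ℕ, Ψ → (Fin k → Bool), (∀ k, Measurable (g k)) ∧
      (∀ x y k l, k ≤ l → g l x = g l y → g k x = g k y) ∧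
      ∀ x y, (∀ k, g k x = g k y) → x = y := by
  obtain ⟨f, hf, hinj⟩ := MeasurableSpace.measurable_injection_nat_bool_of_countablySeparated Ψ
  refine ⟨fun k x i => f x i, fun k => by fun_prop, fun x y k l hkl h => ?_, fun x y h => ?_⟩
  · ext i
    exact congrFun h (Fin.castLE hkl i)
  · exact hinj (funext fun i => congrFun (h (i + 1)) ⟨i, i.lt_succ_self⟩)

lemma measure_singleton_eq_iInf {Ψ : Type*} [MeasurableSpace Ψ]
    {g : ∀ k : ℕ, Ψ → (Fin k → Bool)} (hg : ∀ k, Measurable (g k))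
    (hmono : ∀ x y k l, k ≤ l → g l x = g l y → g k x = g k y)
    (hsep : ∀ x y, (∀ k, g k x = g k y) → x = y)
    {m : Measure Ψ} {D : Set Ψ} (hD : MeasurableSet D) (hm : m D < ∞) {x : Ψ} (hx : x ∈ D) :
    ⨅ k, m (D ∩ g k ⁻¹' {g k x}) = m {x} := by
  have h : ⋂ k, D ∩ g k ⁻¹' {g k x} = {x} := by
    ext y
    simp only [mem_iInter, mem_inter_iff, mem_preimage, mem_singleton_iff]
    exact ⟨fun h => hsep y x fun k => (h k).2, by rintro rfl k; exact ⟨hx, rfl⟩⟩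
  -- Continuity from above; the cells around `x` decrease to `{x}` by separation.
  have hanti : Antitone fun k => D ∩ g k ⁻¹' {g k x} := fun k l hkl y hy =>
    ⟨hy.1, hmono y x k l hkl hy.2⟩
  rw [← h, hanti.measure_iInter
    (fun k => (hD.inter (hg k (measurableSet_singleton _))).nullMeasurableSet)
    ⟨0, ((measure_mono inter_subset_left).trans_lt hm).ne⟩]

/-- Reweighting by a function of the point masses is a measurable operation on the measures that are
finite on `D`, restricted to `D`. -/
lemma exists_measurable_restrict_withDensity {Ψ : Type*} [MeasurableSpace Ψ]
    [MeasurableSpace.CountablySeparated Ψ] {D : Set Ψ} (hD : MeasurableSet D)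
    {h : ℝ≥0∞ → ℝ≥0∞} (hh : Measurable h) :
    ∃ T : Measure Ψ → Measure Ψ, Measurable T ∧ ∀ m, m D < ∞ →
      T m = (m.restrict D).withDensity (fun x => h (m {x})) := by
  obtain ⟨g, hg, hmono, hsep⟩ := exists_finite_separating_maps Ψ
  have hmeasD : Measurable fun m : Measure Ψ => m D := Measure.measurable_coe hD
  -- Dividing by `1 + m D` makes the restriction to `D` a finite kernel.
  let κ : Kernel (Measure Ψ) Ψ :=
    { toFun := fun m => (1 + m D)⁻¹ • m.restrict D
      measurable' := by
        refine Measure.measurable_of_measurable_coe _ fun s hs => ?_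
        simp only [Measure.smul_apply, smul_eq_mul, Measure.restrict_apply hs]
        exact (measurable_const.add hmeasD).inv.mul (Measure.measurable_coe (hs.inter hD)) }
  have hκ : IsFiniteKernel κ := ⟨1, ENNReal.one_lt_top, fun m => by
    change ((1 + m D)⁻¹ • m.restrict D) univ ≤ 1
    rw [Measure.smul_apply, smul_eq_mul, Measure.restrict_apply_univ, mul_comm,
      ← div_eq_mul_inv]
    exact ENNReal.div_le_of_le_mul (by rw [one_mul]; exact le_add_self)⟩
  -- `F m x` equals `m {x}` when `m D` is finite and `x ∈ D`, and is jointly measurable because the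
  -- cell around `x` takes finitely many values.
  let F : Measure Ψ → Ψ → ℝ≥0∞ := fun m x => ⨅ k, m (D ∩ g k ⁻¹' {g k x})
  have hF : Measurable (Function.uncurry F) := by
    refine Measurable.iInf fun k => ?_
    have h1 : Measurable fun p : Measure Ψ × (Fin k → Bool) => p.1 (D ∩ g k ⁻¹' {p.2}) :=
      measurable_from_prod_countable_left fun s =>
        Measure.measurable_coe (hD.inter (hg k (measurableSet_singleton s)))
    exact h1.comp (measurable_fst.prodMk ((hg k).comp measurable_snd))
  have hG : Measurable (Function.uncurry fun m x => (1 + m D) * h (F m x)) :=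
    (measurable_const.add (hmeasD.comp measurable_fst)).mul (hh.comp hF)
  refine ⟨κ.withDensity fun m x => (1 + m D) * h (F m x), Kernel.measurable _, fun m hm => ?_⟩
  have h0 : (1 + m D) ≠ 0 := by simp
  have htop : (1 + m D) ≠ ∞ := ENNReal.add_ne_top.2 ⟨ENNReal.one_ne_top, hm.ne⟩
  have hκm : κ m = (1 + m D)⁻¹ • m.restrict D := rfl
  have hFm : Measurable (F m) := hF.comp (measurable_const.prodMk measurable_id)
  rw [Kernel.withDensity_apply _ hG, hκm, withDensity_smul_measure]
  have : (fun x => (1 + m D) * h (F m x)) = (1 + m D) • fun x => h (F m x) := rfl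
  rw [this, withDensity_smul (f := fun x => h (F m x)) _ (hh.comp hFm), smul_smul,
    ENNReal.inv_mul_cancel h0 htop, one_smul]
  refine withDensity_congr_ae ((ae_restrict_mem hD).mono fun x hx => ?_)
  simp only [F, measure_singleton_eq_iInf hg hmono hsep hD hm hx]

/-- Reweighting by a function of the point masses is a measurable operation on the measures that are
finite on every cell of a given countable partition. -/
lemma exists_measurable_withDensity_singleton {Ψ ι : Type*} [MeasurableSpace Ψ]
    [MeasurableSpace.CountablySeparated Ψ] [Countable ι] {D : ι → Set Ψ}
    (hD : ∀ i, MeasurableSet (D i)) (hdisj : Pairwise (Function.onFun Disjoint D))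
    (hunion : ⋃ i, D i = univ) {h : ℝ≥0∞ → ℝ≥0∞} (hh : Measurable h) :
    ∃ T : Measure Ψ → Measure Ψ, Measurable T ∧ ∀ m, (∀ i, m (D i) < ∞) →
      T m = m.withDensity (fun x => h (m {x})) := by
  choose T hT hTm using fun i => exists_measurable_restrict_withDensity (hD i) hh
  refine ⟨fun m => Measure.sum fun i => T i m, ?_, fun m hm => ?_⟩
  · refine Measure.measurable_of_measurable_coe _ fun s hs => ?_
    simp only [Measure.sum_apply _ hs]
    exact Measurable.tsum fun i => (Measure.measurable_coe hs).comp (hT i)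
  · have hsum : m = Measure.sum fun i => m.restrict (D i) := by
      have h1 := Measure.restrict_iUnion (μ := m) hdisj hD
      rwa [hunion, Measure.restrict_univ] at h1
    have hw : ∀ f, m.withDensity f = Measure.sum fun i => (m.restrict (D i)).withDensity f :=
      fun f => (congrArg (fun m' => m'.withDensity f) hsum).trans (withDensity_sum _ f)
    rw [hw]
    exact congrArg Measure.sum (funext fun i => hTm i m (hm i))

/-! ### Poisson distribution and Poisson processes -/

lemma lintegral_natCast_poissonMeasure (r : ℝ≥0) : ∫⁻ n, (n : ℝ≥0∞) ∂poissonMeasure r = r := by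
  -- `(n + 1) / (n + 1)! = 1 / n!`: each term is `r` times the preceding Poisson weight.
  have hshift : ∀ n : ℕ, ENNReal.ofReal (Real.exp (-r) * (r : ℝ) ^ (n + 1) / (n + 1).factorial)
      * ((n + 1 : ℕ) : ℝ≥0∞) =
      r * ENNReal.ofReal (Real.exp (-r) * (r : ℝ) ^ n / n.factorial) := fun n => by
    rw [← ENNReal.ofReal_natCast (n + 1), ← ENNReal.ofReal_coe_nnreal (p := r),
      ← ENNReal.ofReal_mul (by positivity), ← ENNReal.ofReal_mul (by positivity)]
    congr 1
    rw [Nat.factorial_succ]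
    push_cast
    field_simp
    ring
  have hone : ∑' n : ℕ, ENNReal.ofReal (Real.exp (-r) * (r : ℝ) ^ n / n.factorial) = 1 := by
    rw [← ENNReal.ofReal_tsum_of_nonneg (fun n => by positivity)
      (hasSum_one_poissonMeasure r).summable, (hasSum_one_poissonMeasure r).tsum_eq,
      ENNReal.ofReal_one]
  rw [poissonMeasure, lintegral_sum_measure]
  simp only [lintegral_smul_measure, lintegral_dirac, smul_eq_mul]
  rw [tsum_eq_zero_add' ENNReal.summable]
  simp only [hshift, ENNReal.tsum_mul_left, hone]
  simp

/-- From `1 - e⁻ʳ (1 + r) ≤ 1 - (1 - r) (1 + r) = r ^ 2`. -/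
lemma poissonMeasure_one_lt_le_sq (r : ℝ≥0) :
    poissonMeasure r {n | 1 < n} ≤ (r : ℝ≥0∞) ^ 2 := by
  have hcompl : ({n | 1 < n} : Set ℕ) = ({0} ∪ {1})ᶜ := by
    ext n
    simp only [mem_ofPred_eq, mem_compl_iff, mem_union, mem_singleton_iff]
    omega
  have hreal : (poissonMeasure r).real {n | 1 < n} ≤ (r : ℝ) ^ 2 := by
    rw [hcompl, probReal_compl_eq_one_sub (by measurability),
      measureReal_union (by simp) (measurableSet_singleton _),
      poissonMeasure_real_singleton, poissonMeasure_real_singleton]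
    have h := Real.add_one_le_exp (-(r : ℝ))
    have h0 : (0 : ℝ) ≤ r := r.2
    norm_num
    nlinarith
  rw [← ENNReal.ofReal_coe_nnreal, ← ENNReal.ofReal_pow r.coe_nonneg, ← ofReal_measureReal]
  exact ENNReal.ofReal_le_ofReal hreal

section Poisson

variable {Ω E E' : Type*} [MeasurableSpace Ω] [MeasurableSpace E] [MeasurableSpace E']
  {P : Measure Ω} {N : Ω → Measure E} {μ : Measure E}

/-- Campbell's formula: the mean measure of a Poisson process is its intensity. -/
lemma IsPoissonProcess.bind_eq [IsProbabilityMeasure P] (h : IsPoissonProcess P N μ) :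
    P.bind N = μ := by
  ext A hA
  rw [Measure.bind_apply hA h.measurable.aemeasurable]
  by_cases hμ : μ A = ∞
  · rw [lintegral_congr_ae (h.count_infinite A hA hμ), lintegral_const, measure_univ, mul_one, hμ]
  · have hlaw := h.law_count A hA hμ
    rw [← lintegral_map' (f := fun t : ℝ≥0∞ => t) (by fun_prop) hlaw.aemeasurable, hlaw.map_eq,
      lintegral_map (by fun_prop) (by fun_prop), lintegral_natCast_poissonMeasure,
      ENNReal.coe_toNNReal hμ]

lemma IsPoissonProcess.measure_one_lt_le_sq (h : IsPoissonProcess P N μ) {A : Set E}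
    (hA : MeasurableSet A) (hμ : μ A ≠ ∞) : P {ω | 1 < N ω A} ≤ μ A ^ 2 := by
  rw [(h.law_count A hA hμ).measure_eq (p := fun t => 1 < t) measurableSet_Ioi,
    Measure.map_apply (by fun_prop) (show MeasurableSet {t : ℝ≥0∞ | 1 < t} from measurableSet_Ioi)]
  have : (fun n : ℕ => (n : ℝ≥0∞)) ⁻¹' {t | 1 < t} = {n | 1 < n} := by
    ext n; simp
  rw [this]
  exact (poissonMeasure_one_lt_le_sq _).trans_eq (by rw [ENNReal.coe_toNNReal hμ])

lemma IsPointMeasure.map {m : Measure E} (hm : IsPointMeasure m) {f : E → E'}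
    (hf : Measurable f) : IsPointMeasure (m.map f) := by
  obtain ⟨s, x, rfl⟩ := hm
  refine ⟨s, fun i => f (x i), ?_⟩
  rw [Measure.map_sum hf.aemeasurable]
  simp only [Measure.map_dirac' hf]

lemma IsPoissonProcess.map_equiv (h : IsPoissonProcess P N μ) (e : E ≃ᵐ E') :
    IsPoissonProcess P (fun ω => (N ω).map e) (μ.map e) where
  measurable := (Measure.measurable_map _ e.measurable).comp h.measurable
  isPointMeasure := h.isPointMeasure.mono fun _ hω => hω.map e.measurable
  law_count A hA hμ := by
    simp only [e.map_apply] at hμ ⊢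
    exact h.law_count _ (e.measurable hA) hμ
  count_infinite A hA hμ := by
    simp only [e.map_apply] at hμ ⊢
    exact h.count_infinite _ (e.measurable hA) hμ
  indep n A hA hdisj := by
    simp only [e.map_apply]
    exact h.indep n _ (fun i => e.measurable (hA i)) fun i j hij => (hdisj hij).preimage e

end Poisson

/-! ### Transport along measurable equivalences of the sample space -/

section Transport

variable {Ω Ω' : Type*} [MeasurableSpace Ω] [MeasurableSpace Ω'] {P : Measure Ω}

lemma hasLaw_map_equiv {X : Type*} [MeasurableSpace X] {f : Ω' → X} {ν : Measure X}
    (e : Ω ≃ᵐ Ω') (h : HasLaw (fun ω => f (e ω)) ν P) : HasLaw f ν (P.map e) where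
  aemeasurable := (aemeasurable_map_equiv_iff e).2 h.aemeasurable
  map_eq := by
    rw [AEMeasurable.map_map_of_aemeasurable ((aemeasurable_map_equiv_iff e).2 h.aemeasurable)
      e.measurable.aemeasurable]
    exact h.map_eq

lemma iIndepFun_map_equiv {κ : Type*} {X : κ → Type*} [∀ i, MeasurableSpace (X i)]
    {f : ∀ i, Ω' → X i} (e : Ω ≃ᵐ Ω') (h : iIndepFun (fun i ω => f i (e ω)) P) :
    iIndepFun f (P.map e) := by
  rw [iIndepFun_iff_measure_inter_preimage_eq_mul] at h ⊢
  intro S sets hsets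
  have := h S hsets
  simp only [e.map_apply, preimage_iInter]
  exact this

lemma indepFun_map_equiv {X Y : Type*} [MeasurableSpace X] [MeasurableSpace Y]
    {f : Ω' → X} {g : Ω' → Y} (e : Ω ≃ᵐ Ω')
    (h : IndepFun (fun ω => f (e ω)) (fun ω => g (e ω)) P) : IndepFun f g (P.map e) := by
  rw [indepFun_iff_measure_inter_preimage_eq_mul] at h ⊢
  intro s t hs ht
  simp only [e.map_apply, preimage_inter]
  exact h s t hs ht

/-- An equivalence of sample spaces is needed here, not just a measurable map: the set of point
measures is not assumed to be measurable. -/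
lemma IsPoissonProcess.of_comp_equiv {E : Type*} [MeasurableSpace E] {N : Ω' → Measure E}
    {μ : Measure E} (e : Ω ≃ᵐ Ω') (h : IsPoissonProcess P (fun ω => N (e ω)) μ) :
    IsPoissonProcess (P.map e) N μ where
  measurable := by
    have := h.measurable.comp e.symm.measurable
    simpa [Function.comp_def] using this
  isPointMeasure := by
    rw [e.measurableEmbedding.ae_map_iff]
    exact h.isPointMeasure
  law_count A hA hμ := hasLaw_map_equiv e (h.law_count A hA hμ)
  count_infinite A hA hμ := by
    rw [e.measurableEmbedding.ae_map_iff]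
    exact h.count_infinite A hA hμ
  indep n A hA hdisj := iIndepFun_map_equiv e (h.indep n A hA hdisj)

end Transport

/-! ### Distinctness of the locations of a Poisson process -/

/-- The sum is the mass under `H.prod H` of the pairs lying in a common cell of the `k`-th partition,
and these sets decrease to the diagonal. -/
lemma tendsto_sum_sq_measure_cells {Ψ : Type*} [MeasurableSpace Ψ]
    {g : ∀ k : ℕ, Ψ → (Fin k → Bool)} (hg : ∀ k, Measurable (g k))
    (hmono : ∀ x y k l, k ≤ l → g l x = g l y → g k x = g k y)
    (hsep : ∀ x y, (∀ k, g k x = g k y) → x = y)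
    (H : Measure Ψ) [IsFiniteMeasure H] (hH : ∀ x, H {x} = 0) :
    Tendsto (fun k => ∑ s, H (g k ⁻¹' {s}) ^ 2) atTop (𝓝 0) := by
  set S : ℕ → Set (Ψ × Ψ) := fun k => ⋃ s, (g k ⁻¹' {s}) ×ˢ (g k ⁻¹' {s}) with hS
  have hmem : ∀ k p, p ∈ S k ↔ g k p.1 = g k p.2 := fun k p => by
    simp only [hS, mem_iUnion, mem_prod, mem_preimage, mem_singleton_iff]
    exact ⟨fun ⟨s, h1, h2⟩ => h1.trans h2.symm, fun h => ⟨_, h, rfl⟩⟩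
  have hcell : ∀ k s, MeasurableSet (g k ⁻¹' {s}) := fun k s => hg k (measurableSet_singleton s)
  have hmeas : ∀ k, MeasurableSet (S k) := fun k =>
    MeasurableSet.iUnion fun s => (hcell k s).prod (hcell k s)
  have hval : ∀ k, (H.prod H) (S k) = ∑ s, H (g k ⁻¹' {s}) ^ 2 := fun k => by
    rw [hS, measure_iUnion _ fun s => (hcell k s).prod (hcell k s), tsum_fintype]
    · simp only [Measure.prod_prod, sq]
    · intro s t hst
      refine Set.disjoint_left.2 fun p hp hp' => hst ?_
      exact (mem_singleton_iff.1 hp.1).symm.trans (mem_singleton_iff.1 hp'.1)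
  have hanti : Antitone S := fun k l hkl p hp =>
    (hmem k p).2 (hmono _ _ k l hkl ((hmem l p).1 hp))
  have hzero : (H.prod H) (⋂ k, S k) = 0 := by
    rw [Measure.prod_apply (MeasurableSet.iInter hmeas)]
    refine lintegral_eq_zero_of_ae_eq_zero (ae_of_all _ fun x => ?_)
    refine measure_mono_null (fun y hy => ?_) (hH x)
    exact (hsep x y fun k => (hmem k _).1 (mem_iInter.1 hy k)).symm
  have := tendsto_measure_iInter_atTop (μ := H.prod H)
    (fun k => (hmeas k).nullMeasurableSet) hanti ⟨0, measure_ne_top _ _⟩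
  rw [hzero] at this
  simpa only [Function.comp_def, hval] using this

/-- Over an atomless first component, no two points of a Poisson process share their location, as
long as their marks are confined to a set of finite intensity. -/
lemma IsPoissonProcess.ae_forall_fiber_le_one {Ω Ψ X : Type*} [MeasurableSpace Ω]
    [MeasurableSpace Ψ] [MeasurableSpace.CountablySeparated Ψ] [MeasurableSpace X]
    {P : Measure Ω} {N : Ω → Measure (Ψ × X)} {H : Measure Ψ} [IsFiniteMeasure H]
    {ν : Measure X} [SFinite ν] (h : IsPoissonProcess P N (H.prod ν)) (hH : ∀ x, H {x} = 0)
    {I : Set X} (hI : MeasurableSet I) (hν : ν I ≠ ∞) :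
    ∀ᵐ ω ∂P, ∀ x, N ω ({x} ×ˢ I) ≤ 1 := by
  obtain ⟨g, hg, hmono, hsep⟩ := exists_finite_separating_maps Ψ
  have hbound : ∀ k, P {ω | ¬ ∀ x, N ω ({x} ×ˢ I) ≤ 1} ≤
      (∑ s, H (g k ⁻¹' {s}) ^ 2) * ν I ^ 2 := fun k => by
    calc P {ω | ¬ ∀ x, N ω ({x} ×ˢ I) ≤ 1}
        ≤ P (⋃ s, {ω | 1 < N ω ((g k ⁻¹' {s}) ×ˢ I)}) := by
          refine measure_mono fun ω hω => ?_
          simp only [mem_ofPred_eq, not_forall, not_le] at hω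
          obtain ⟨x, hx⟩ := hω
          refine mem_iUnion.2 ⟨g k x, hx.trans_le (measure_mono ?_)⟩
          exact prod_mono (by rintro _ rfl; rfl) subset_rfl
      _ ≤ ∑ s, P {ω | 1 < N ω ((g k ⁻¹' {s}) ×ˢ I)} := measure_iUnion_fintype_le _ _
      _ ≤ ∑ s, (H (g k ⁻¹' {s}) * ν I) ^ 2 := by
          refine Finset.sum_le_sum fun s _ => ?_
          rw [← Measure.prod_prod]
          refine h.measure_one_lt_le_sq ((hg k (measurableSet_singleton s)).prod hI) ?_
          rw [Measure.prod_prod]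
          exact ENNReal.mul_ne_top (measure_ne_top _ _) hν
      _ = (∑ s, H (g k ⁻¹' {s}) ^ 2) * ν I ^ 2 := by
          simp only [mul_pow, Finset.sum_mul]
  have hlim := ENNReal.Tendsto.mul_const (b := ν I ^ 2)
    (tendsto_sum_sq_measure_cells hg hmono hsep H hH) (Or.inr (ENNReal.pow_ne_top hν))
  rw [zero_mul] at hlim
  exact le_antisymm (ge_of_tendsto' hlim hbound) bot_le

/-! ### Transforming the components of a completely random measure -/

/-- Push-forward along a measurable equivalence, as an equivalence of spaces of measures. -/
def measureMapEquiv {E E' : Type*} [MeasurableSpace E] [MeasurableSpace E'] (e : E ≃ᵐ E') :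
    Measure E ≃ᵐ Measure E' where
  toFun m := m.map e
  invFun m := m.map e.symm
  left_inv _ := e.map_symm_map
  right_inv _ := e.map_map_symm
  measurable_toFun := Measure.measurable_map _ e.measurable
  measurable_invFun := Measure.measurable_map _ e.symm.measurable

/-- The map `b ↦ b / (1 - b)`, in the form `oddsEquiv`, applied to the marks of all points of the
ordinary component and to all fixed weights. -/
def componentsOddsEquiv (Ψ ι : Type*) [MeasurableSpace Ψ] :
    (Measure (Ψ × ℝ) × (ι → ℝ)) ≃ᵐ (Measure (Ψ × ℝ) × (ι → ℝ)) :=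
  (measureMapEquiv ((MeasurableEquiv.refl Ψ).prodCongr oddsEquiv)).prodCongr
    (MeasurableEquiv.piCongrRight fun _ => oddsEquiv)

/-- The partition of the space into the fixed atoms `x i` and the complement of all of them. -/
def fixedCells {Ψ ι : Type*} (x : ι → Ψ) : Option ι → Set Ψ
  | none => (range x)ᶜ
  | some i => {x i}

lemma pairwise_disjoint_fixedCells {Ψ ι : Type*} {x : ι → Ψ} (hx : Function.Injective x) :
    Pairwise (Function.onFun Disjoint (fixedCells x)) := by
  rintro (_ | i) (_ | j) h
  · exact absurd rfl h
  · exact disjoint_compl_left.mono_right (singleton_subset_iff.2 (mem_range_self j))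
  · exact disjoint_compl_right.mono_left (singleton_subset_iff.2 (mem_range_self i))
  · exact disjoint_singleton.2 fun h' => h (congrArg some (hx h'))

lemma iUnion_fixedCells {Ψ ι : Type*} (x : ι → Ψ) : ⋃ o, fixedCells x o = univ := by
  refine eq_univ_of_forall fun y => ?_
  by_cases hy : y ∈ range x
  · obtain ⟨i, rfl⟩ := hy
    exact mem_iUnion.2 ⟨some i, rfl⟩
  · exact mem_iUnion.2 ⟨none, hy⟩

section Assemble

variable {Ψ ι : Type*} [MeasurableSpace Ψ]

lemma measurable_assemble [Countable ι] (x : ι → Ψ) : Measurable (assemble x) := by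
  refine Measure.measurable_of_measurable_coe _ fun A hA => ?_
  simp only [assemble, Measure.add_apply, Measure.sum_apply _ hA, Measure.smul_apply, smul_eq_mul,
    Measure.map_apply measurable_fst hA, withDensity_apply _ (measurable_fst hA)]
  refine Measurable.add (Measurable.tsum fun i => ?_) ?_
  · fun_prop
  · simp only [← lintegral_indicator (measurable_fst hA)]
    exact (Measure.measurable_lintegral (Measurable.indicator (by fun_prop)
      (measurable_fst hA))).comp measurable_fst

/-- The assembled measure as a single family of weighted point masses, indexed by the fixed atoms and
the points of the ordinary component together. -/
lemma assemble_eq_sum {κ : Type*} [MeasurableSingletonClass Ψ] (x : ι → Ψ)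
    {c : Measure (Ψ × ℝ) × (ι → ℝ)} {p : κ → Ψ × ℝ}
    (hc : c.1 = Measure.sum fun j => Measure.dirac (p j)) :
    assemble x c = Measure.sum fun k : ι ⊕ κ =>
      ENNReal.ofReal (Sum.elim c.2 (fun j => (p j).2) k) •
        Measure.dirac (Sum.elim x (fun j => (p j).1) k) := by
  have hord : (c.1.withDensity (fun p => ENNReal.ofReal p.2)).map Prod.fst =
      Measure.sum fun j => ENNReal.ofReal (p j).2 • Measure.dirac (p j).1 := by
    rw [hc, withDensity_sum, Measure.map_sum measurable_fst.aemeasurable]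
    congr 1
    ext1 j
    rw [dirac_withDensity, Measure.map_smul, Measure.map_dirac' measurable_fst]
  rw [assemble, hord]
  ext A hA
  rw [Measure.add_apply, Measure.sum_apply _ hA, Measure.sum_apply _ hA, Measure.sum_apply _ hA,
    Summable.tsum_sum ENNReal.summable ENNReal.summable]
  rfl

/-- Two points with positive marks at the same location both have marks at least `1 / (n + 1)` for
some `n`. -/
lemma fst_injective_of_fiber_le_one {κ : Type*} [MeasurableSingletonClass Ψ] {p : κ → Ψ × ℝ}
    (hpos : ∀ j, 0 < (p j).2)
    (hfib : ∀ (n : ℕ) (y : Ψ), (Measure.sum fun j => Measure.dirac (p j))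
      ({y} ×ˢ Ici (1 / ((n : ℝ) + 1))) ≤ 1) :
    Function.Injective fun j => (p j).1 := by
  classical
  intro i j hij
  by_contra hne
  obtain ⟨n, hn⟩ := exists_nat_one_div_lt (lt_min (hpos i) (hpos j))
  obtain ⟨hi, hj⟩ := lt_min_iff.1 hn
  have h := hfib n (p i).1
  rw [Measure.sum_apply _ ((measurableSet_singleton _).prod measurableSet_Ici)] at h
  have h2 := (ENNReal.sum_le_tsum ({i, j} : Finset κ)).trans h
  have hmi : p i ∈ ({(p i).1} ×ˢ Ici (1 / ((n : ℝ) + 1)) : Set (Ψ × ℝ)) := ⟨rfl, hi.le⟩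
  have hmj : p j ∈ ({(p i).1} ×ˢ Ici (1 / ((n : ℝ) + 1)) : Set (Ψ × ℝ)) := ⟨hij.symm, hj.le⟩
  rw [Finset.sum_pair hne, Measure.dirac_apply_of_mem hmi, Measure.dirac_apply_of_mem hmj] at h2
  norm_num at h2

/-- Reweighting the assembled measure atom by atom agrees with transforming its components, provided
all locations are distinct. -/
lemma assemble_withDensity_oddsRatio [MeasurableSingletonClass Ψ] {x : ι → Ψ}
    (hx : Function.Injective x) {c : Measure (Ψ × ℝ) × (ι → ℝ)} (hc : IsPointMeasure c.1)
    (hpos : ∀ᵐ p ∂c.1, 0 < p.2) (hfix : ∀ᵐ p ∂c.1, p.1 ∉ range x)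
    (hfib : ∀ (n : ℕ) (y : Ψ), c.1 ({y} ×ˢ Ici (1 / ((n : ℝ) + 1))) ≤ 1) :
    (assemble x c).withDensity (fun y => oddsRatio (assemble x c {y})) =
      assemble x (componentsOddsEquiv Ψ ι c) := by
  obtain ⟨s, p, hp⟩ := hc
  have hae : ∀ {q : Ψ × ℝ → Prop}, (∀ᵐ p ∂c.1, q p) → ∀ j, q (p j) := fun {q} h j => by
    rw [hp, Measure.ae_sum_eq, Filter.eventually_iSup] at h
    exact (ae_dirac_eq (p j) ▸ h j : ∀ᶠ p in pure (p j), q p)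
  have hinj : Function.Injective (Sum.elim x fun j => (p j).1) := by
    refine hx.sumElim (fst_injective_of_fiber_le_one (hae hpos) (hp ▸ hfib)) fun i j h => ?_
    exact hae hfix j ⟨i, h⟩
  have hp' : (componentsOddsEquiv Ψ ι c).1 =
      Measure.sum fun j => Measure.dirac ((p j).1, oddsEquiv (p j).2) := by
    change c.1.map ((MeasurableEquiv.refl Ψ).prodCongr oddsEquiv) = _
    rw [hp, Measure.map_sum (MeasurableEquiv.measurable _).aemeasurable]
    simp only [Measure.map_dirac' (MeasurableEquiv.measurable _)]
    rfl
  rw [sum_dirac_withDensity_oddsRatio _ hinj (assemble_eq_sum x hp), assemble_eq_sum x hp']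
  congr 1
  ext1 k
  rcases k with i | j
  · change _ = ENNReal.ofReal (oddsEquiv (c.2 i)) • Measure.dirac (x i)
    rw [ofReal_oddsEquiv]
    rfl
  · change _ = ENNReal.ofReal (oddsEquiv (p j).2) • Measure.dirac (p j).1
    rw [ofReal_oddsEquiv]
    rfl

lemma measurableSet_fixedCells [Countable ι] [MeasurableSingletonClass Ψ] (x : ι → Ψ)
    (o : Option ι) : MeasurableSet (fixedCells x o) := by
  cases o with
  | none => exact (countable_range x).measurableSet.compl
  | some i => exact measurableSet_singleton _

/-- The total mass of the fixed atoms may be infinite, but each cell of `fixedCells` meets at most one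
of them. -/
lemma assemble_fixedCells_lt_top [Countable ι] [MeasurableSingletonClass Ψ] {x : ι → Ψ}
    (hx : Function.Injective x) {c : Measure (Ψ × ℝ) × (ι → ℝ)}
    (hfin : ∫⁻ p, ENNReal.ofReal p.2 ∂c.1 < ∞) (o : Option ι) :
    assemble x c (fixedCells x o) < ∞ := by
  have hA := measurableSet_fixedCells x o
  rw [assemble, Measure.add_apply, Measure.map_apply measurable_fst hA,
    withDensity_apply _ (measurable_fst hA)]
  refine ENNReal.add_lt_top.2 ⟨?_, (setLIntegral_le_lintegral _ _).trans_lt hfin⟩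
  cases o with
  | none =>
    rw [Measure.sum_apply _ hA]
    have : ∀ i, x i ∉ fixedCells x none := fun i h => h (mem_range_self i)
    simp [hA, this]
  | some i =>
    exact (sum_dirac_singleton (fun i => ENNReal.ofReal (c.2 i)) hx i).trans_lt
      ENNReal.ofReal_lt_top

end Assemble

/-- Applying `b ↦ b / (1 - b)` to the weights of an atomic completely random measure pushes the laws
of its fixed weights and its Lévy measure forward along that map. -/
theorem IsCRM.atomicMeasure_odds {Ω Ψ ι : Type*} [MeasurableSpace Ω] [MeasurableSpace Ψ]
    [MeasurableSpace.CountablySeparated Ψ] [Countable ι] {P : Measure Ω}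
    {x : ι → Ψ} (hx : Function.Injective x) {F : ι → Measure ℝ}
    {H : Measure Ψ} [IsFiniteMeasure H] (hH : ∀ y, H {y} = 0)
    {ν : Measure ℝ} [SFinite ν] (hpos : ∀ᵐ u ∂ν, 0 < u) (hfin : ∫⁻ u, ENNReal.ofReal u ∂ν < ∞)
    {b : ℕ → Ω → ℝ} {ψ : ℕ → Ω → Ψ} (hψ : ∀ᵐ ω ∂P, Function.Injective fun k => ψ k ω)
    (hB : IsCRM P (atomicMeasure b ψ) x F (H.prod ν)) :
    IsCRM P (atomicMeasure (fun k ω => b k ω / (1 - b k ω)) ψ) x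
      (fun i => (F i).map oddsEquiv) (H.prod (ν.map oddsEquiv)) := by
  have := MeasurableSpace.measurableSingletonClass_of_countablySeparated (α := Ψ)
  obtain ⟨Q, hQ, hN, hF, hFindep, hindep, hlaw⟩ := hB
  obtain ⟨T, hT, hTeq⟩ := exists_measurable_withDensity_singleton (measurableSet_fixedCells x)
    (pairwise_disjoint_fixedCells hx) (iUnion_fixedCells x) measurable_oddsRatio
  set Φ := componentsOddsEquiv Ψ ι
  have hbind := hN.bind_eq
  have hNmeas : AEMeasurable (fun c : Measure (Ψ × ℝ) × (ι → ℝ) => c.1) Q :=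
    measurable_fst.aemeasurable
  have hNpos : ∀ᵐ c ∂Q, ∀ᵐ p ∂c.1, 0 < p.2 := by
    refine Measure.ae_ae_of_ae_bind hNmeas ?_
    rw [hbind]
    exact Measure.quasiMeasurePreserving_snd.ae hpos
  have hNfix : ∀ᵐ c ∂Q, ∀ᵐ p ∂c.1, p.1 ∉ range x := by
    refine Measure.ae_ae_of_ae_bind hNmeas ?_
    rw [hbind]
    refine Measure.quasiMeasurePreserving_fst.ae (p := fun y => y ∉ range x) ?_
    rw [ae_iff]
    simp only [not_not]
    exact (measure_null_iff_singleton (countable_range x)).2 fun y _ => hH y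
  have hNfin : ∀ᵐ c ∂Q, ∫⁻ p, ENNReal.ofReal p.2 ∂c.1 < ∞ := by
    refine ae_lt_top (Measure.measurable_lintegral (by fun_prop) |>.comp measurable_fst) ?_
    have h := Measure.lintegral_bind (f := fun p : Ψ × ℝ => ENNReal.ofReal p.2) hNmeas
      (by fun_prop)
    rw [hbind, lintegral_prod _ (by fun_prop)] at h
    refine ne_of_eq_of_ne h.symm ?_
    simp only [lintegral_const]
    exact ENNReal.mul_ne_top hfin.ne (measure_ne_top _ _)
  have hNfib : ∀ᵐ c ∂Q, ∀ (n : ℕ) (y : Ψ), c.1 ({y} ×ˢ Ici (1 / ((n : ℝ) + 1))) ≤ 1 := by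
    refine ae_all_iff.2 fun n => hN.ae_forall_fiber_le_one hH measurableSet_Ici ?_
    have hn : (0 : ℝ) < 1 / ((n : ℝ) + 1) := by positivity
    -- Markov: marks at least `1 / (n + 1)` have finite intensity as `∫ u ν(du) < ∞`.
    have hle := meas_ge_le_lintegral_div (μ := ν) (f := fun u => ENNReal.ofReal u) (by fun_prop)
      (ε := ENNReal.ofReal (1 / ((n : ℝ) + 1))) (by simpa using hn) ENNReal.ofReal_ne_top
    refine ((measure_mono fun u hu => ?_).trans_lt
      (hle.trans_lt (ENNReal.div_lt_top hfin.ne (by simpa using hn)))).ne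
    exact ENNReal.ofReal_le_ofReal hu
  have hTassemble : ∀ᵐ c ∂Q, T (assemble x c) = assemble x (Φ c) := by
    filter_upwards [hN.isPointMeasure, hNpos, hNfix, hNfin, hNfib] with c h1 h2 h3 h4 h5
    rw [hTeq _ (assemble_fixedCells_lt_top hx h4), assemble_withDensity_oddsRatio hx h1 h2 h3 h5]
  have hmeasA := measurable_assemble x
  have hBfin : ∀ᵐ ω ∂P, ∀ o, atomicMeasure b ψ ω (fixedCells x o) < ∞ := by
    refine ae_all_iff.2 fun o => ?_
    -- Finiteness on a cell is a property of the law, so it passes from the assembled measure to `B`.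
    have hset : MeasurableSet {m : Measure Ψ | m (fixedCells x o) < ∞} :=
      measurableSet_lt (Measure.measurable_coe (measurableSet_fixedCells x o)) measurable_const
    refine ae_of_ae_map (p := fun m : Measure Ψ => m (fixedCells x o) < ∞) hlaw.aemeasurable ?_
    rw [hlaw.map_eq, ae_map_iff hmeasA.aemeasurable hset]
    exact hNfin.mono fun c hc => assemble_fixedCells_lt_top hx hc o
  have hTB : ∀ᵐ ω ∂P, T (atomicMeasure b ψ ω) =
      atomicMeasure (fun k ω => b k ω / (1 - b k ω)) ψ ω := by
    filter_upwards [hBfin, hψ] with ω h1 h2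
    exact (hTeq _ h1).trans (sum_dirac_withDensity_oddsRatio (fun k => b k ω) h2 rfl)
  refine ⟨Q.map Φ, Measure.isProbabilityMeasure_map Φ.measurable.aemeasurable, ?_, ?_, ?_, ?_, ?_⟩
  · refine IsPoissonProcess.of_comp_equiv Φ ?_
    have h := hN.map_equiv ((MeasurableEquiv.refl Ψ).prodCongr oddsEquiv)
    have hprod : (H.prod ν).map ((MeasurableEquiv.refl Ψ).prodCongr oddsEquiv) =
        H.prod (ν.map oddsEquiv) := by
      have := Measure.map_prod_map H ν measurable_id oddsEquiv.measurable
      rw [Measure.map_id] at this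
      exact this.symm
    rw [hprod] at h
    exact h
  · intro i
    refine hasLaw_map_equiv Φ ⟨?_, ?_⟩
    · exact oddsEquiv.measurable.comp_aemeasurable (hF i).aemeasurable
    · beta_reduce
      rw [← (hF i).map_eq, AEMeasurable.map_map_of_aemeasurable oddsEquiv.measurable.aemeasurable
        (hF i).aemeasurable]
      rfl
  · exact iIndepFun_map_equiv Φ (hFindep.comp (fun _ => oddsEquiv) fun _ => oddsEquiv.measurable)
  · exact indepFun_map_equiv Φ (hindep.comp
      (measureMapEquiv ((MeasurableEquiv.refl Ψ).prodCongr oddsEquiv)).measurable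
      (MeasurableEquiv.piCongrRight fun _ => oddsEquiv).measurable)
  · refine HasLaw.congr (X := fun ω => T (atomicMeasure b ψ ω))
      ⟨hT.comp_aemeasurable hlaw.aemeasurable, ?_⟩ (hTB.mono fun _ h => h.symm)
    calc P.map (fun ω => T (atomicMeasure b ψ ω))
        = (P.map (atomicMeasure b ψ)).map T :=
          (AEMeasurable.map_map_of_aemeasurable hT.aemeasurable hlaw.aemeasurable).symm
      _ = Q.map (T ∘ assemble x) := by rw [hlaw.map_eq, Measure.map_map hT hmeasA]
      _ = Q.map (assemble x ∘ Φ) := Measure.map_congr hTassemble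
      _ = (Q.map Φ).map (assemble x) := (Measure.map_map hmeasA Φ.measurable).symm

/-! ### The beta process -/

/-- The mean total mass of the ordinary component: `b ν(db)` is `γ` times the `Beta(1, θ)` law. -/
lemma lintegral_betaIntensity {θ γ : ℝ} (hθ : 0 < θ) (hγ : 0 ≤ γ) :
    ∫⁻ u, ENNReal.ofReal u ∂betaIntensity θ γ = ENNReal.ofReal γ := by
  have hbeta : beta 1 θ = θ⁻¹ := by
    rw [beta, Real.Gamma_one, one_mul, add_comm, Real.Gamma_add_one hθ.ne']
    have := (Real.Gamma_pos_of_pos hθ).ne'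
    field_simp
  rw [betaIntensity, lintegral_withDensity_eq_lintegral_mul _ (by fun_prop) (by fun_prop)]
  calc _ = ∫⁻ u in Ioo (0 : ℝ) 1, ENNReal.ofReal γ *
        ENNReal.ofReal (1 / beta 1 θ * u ^ ((1 : ℝ) - 1) * (1 - u) ^ (θ - 1)) := by
        refine setLIntegral_congr_fun measurableSet_Ioo fun u hu => ?_
        have h0 : u ≠ 0 := hu.1.ne'
        have h1 : 0 ≤ (1 - u) ^ (θ - 1) := Real.rpow_nonneg (by linarith [hu.2]) _
        have h2 : 0 ≤ u⁻¹ := inv_nonneg.2 hu.1.le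
        simp only [Pi.mul_apply]
        rw [← ENNReal.ofReal_mul (by positivity), ← ENNReal.ofReal_mul hγ, hbeta, sub_self,
          Real.rpow_zero]
        congr 1
        field_simp
    _ = ENNReal.ofReal γ := by
        rw [lintegral_const_mul _ (by fun_prop), ← lintegral_betaPDF,
          lintegral_betaPDF_eq_one one_pos hθ, mul_one]

end BetaPrime

end

theorem mainTheorem5 {Ω Ψ : Type*} [MeasurableSpace Ω] [MeasurableSpace Ψ]
    [MeasurableSpace.CountablySeparated Ψ]
    (P : Measure Ω) [IsProbabilityMeasure P]
    (θ γ : ℝ) (hθ : 0 < θ) (hγ : 0 < γ)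
    (H : Measure Ψ) (hH : BetaPrime.IsBaseMeasure γ H)
    (b : ℕ → Ω → ℝ) (ψ : ℕ → Ω → Ψ)
    (hb : ∀ k, Measurable (b k)) (hψ : ∀ k, Measurable (ψ k))
    (hb_nonneg : ∀ᵐ ω ∂P, ∀ k, 0 ≤ b k ω)
    (hψ_distinct : ∀ᵐ ω ∂P, Function.Injective (fun k => ψ k ω))
    (hB : BetaPrime.IsBetaProcess θ γ H P (BetaPrime.atomicMeasure b ψ)) :
    BetaPrime.IsBetaPrimeProcess θ γ H P
      (BetaPrime.atomicMeasure (fun k ω => b k ω / (1 - b k ω)) ψ) := by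
  have := MeasurableSpace.measurableSingletonClass_of_countablySeparated (α := Ψ)
  have : Countable (BetaPrime.atoms H) := hH.countable_atoms.to_subtype
  have := hH.ordinary_prob
  have hatomless : ∀ y, BetaPrime.ordinaryPart H {y} = 0 := fun y => by
    rw [BetaPrime.ordinaryPart, Measure.restrict_apply (measurableSet_singleton y)]
    by_cases hy : H {y} = 0
    · exact measure_mono_null inter_subset_left hy
    · rw [(disjoint_singleton_left.2 fun h : y ∈ (BetaPrime.atoms H)ᶜ => h hy).inter_eq,
        measure_empty]
  have hpos : ∀ᵐ u ∂BetaPrime.betaIntensity θ γ, 0 < u :=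
    (withDensity_absolutelyContinuous _ _).ae_le
      ((ae_restrict_mem measurableSet_Ioo).mono fun u hu => hu.1)
  have hfin : ∫⁻ u, ENNReal.ofReal u ∂BetaPrime.betaIntensity θ γ < ∞ :=
    (BetaPrime.lintegral_betaIntensity hθ hγ.le).trans_lt ENNReal.ofReal_lt_top
  have : SFinite (BetaPrime.betaIntensity θ γ) := by
    unfold BetaPrime.betaIntensity
    infer_instance
  have h := BetaPrime.IsCRM.atomicMeasure_odds Subtype.val_injective hatomless hpos hfin
    hψ_distinct hB
  simp only [BetaPrime.map_oddsEquiv_betaMeasure, BetaPrime.map_oddsEquiv_betaIntensity] at h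
  exact h
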